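/- Let $\mathbb{H}$ be the hyperbolic plane with its metric of constant curvature $-1$, let $\mathrm{Vol}$ be the hyperbolic area and $\Delta_{\mathbb{H}}$ the positive Laplacian. For a domain (non-empty, connected, open set) $\Omega\subset\mathbb{H}$ let $H^1_0(\Omega)$ be the closure of $C_c^\infty(\Omega)$ in the norm $(\|u\|_{L^2}^2+\|\nabla u\|_{L^2}^2)^{1/2}$. A real number $\mu$ is a Dirichlet eigenvalue of $\Omega$ if there is $\psi\in H^1_0(\Omega)$, $\psi\neq 0$, solving $$\Delta_{\mathbb{H}}\psi=\mu\psi \ \text{ in } \Omega,\qquad \psi=0\ \text{ on }\partial\Omega$$ in the weak sense, that is, $\int_{\Omega}\langle\nabla\psi,\nabla v\rangle\,d\mathrm{Vol}=\mu\int_{\Omega}\psi v\,d\mathrm{Vol}$ for all $v\in H^1_0(\Omega)$. Let $\lambda_1(\Omega)$ denote the smallest Dirichlet eigenvalue of $\Omega$. Fix $\epsilon_0>0$. Then there exists $C_0>0$, depending only on $\epsilon_0$, such that for every domain $\Omega\subset\mathbb{H}$ with $\mathrm{Vol}(\Omega)\leq\epsilon_0$, the smallest Dirichlet eigenvalue $\lambda_1(\Omega)$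 exists and $$\lambda_1(\Omega)\geq\frac{C_0}{\mathrm{Vol}(\Omega)}.$$ -/

import Mathlib

open MeasureTheory Set
open scoped ContDiff UpperHalfPlane

noncomputable section

namespace HypDirichlet

/-- `L²(ℍ)`: square-integrable real functions on the hyperbolic plane, for the hyperbolic area
`dx dy / y²` (Mathlib's `volume` on the upper half-plane). -/
abbrev L2Fun : Type := Lp ℝ 2 (volume : Measure ℍ)

/-- Square-integrable vector fields on the hyperbolic plane, for the hyperbolic area. A field is
written in the orthonormal frame `(y ∂ₓ, y ∂_y)` of the metric `(dx² + dy²) / y²`, and its two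
components are the real and imaginary part of a complex number, so that the pointwise inner
product of `ℂ` as a real Euclidean plane is the Riemannian one. -/
abbrev L2Vec : Type := Lp ℂ 2 (volume : Measure ℍ)

/-- `φ ∈ C_c^∞(Ω)`: a smooth real function whose support is compact and contained in `Ω`,
regarded as a function on the plane through extension by zero. -/
structure IsTestFunction (Ω : Set ℍ) (φ : ℂ → ℝ) : Prop where
  contDiff : ContDiff ℝ ∞ φ
  hasCompactSupport : HasCompactSupport φ
  tsupport_subset : tsupport φ ⊆ UpperHalfPlane.coe '' Ω

/-- The hyperbolic gradient `y² (∂ₓφ ∂ₓ + ∂_yφ ∂_y)` in the orthonormal frame `(y ∂ₓ, y ∂_y)`: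
its components are `y ∂ₓφ` and `y ∂_yφ`. -/
def hypGrad (φ : ℂ → ℝ) (z : ℍ) : ℂ := z.im • gradient φ (z : ℂ)

/-- The pairs `(φ, ∇φ)` for `φ ∈ C_c^∞(Ω)`, as classes in `L² × L²`. -/
def testGraph (Ω : Set ℍ) : Set (L2Fun × L2Vec) :=
  {p | ∃ φ : ℂ → ℝ, IsTestFunction Ω φ ∧
    (∀ᵐ z : ℍ, p.1 z = φ (z : ℂ)) ∧ (∀ᵐ z : ℍ, p.2 z = hypGrad φ z)}

/-- The Sobolev space `H¹₀(Ω)`, the closure of `C_c^∞(Ω)` in the `H¹`-norm. An element is given as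
the pair `(u, ∇u)` of a function and its weak gradient. -/
def H10 (Ω : Set ℍ) : Set (L2Fun × L2Vec) := closure (testGraph Ω)

/-- `u` is a (weak) solution in `H¹₀(Ω)` of the Dirichlet problem `Δ u = μ u` in `Ω`, `u = 0` on
`∂Ω`, for the positive hyperbolic Laplacian: `∫ ⟨∇u, ∇v⟩ dVol = μ ∫ u v dVol` for all
`v ∈ H¹₀(Ω)`. -/
def SolvesDirichlet (Ω : Set ℍ) (μ : ℝ) (u : L2Fun × L2Vec) : Prop :=
  u ∈ H10 Ω ∧ ∀ v ∈ H10 Ω, inner ℝ u.2 v.2 = μ * inner ℝ u.1 v.1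

/-- The eigenvalues of the Dirichlet problem on `Ω`. -/
def dirichletEigenvalues (Ω : Set ℍ) : Set ℝ :=
  {μ | ∃ u : L2Fun × L2Vec, u.1 ≠ 0 ∧ SolvesDirichlet Ω μ u}

/-- The first Dirichlet eigenvalue `λ₁(Ω)`. -/
def lambda1 (Ω : Set ℍ) : ℝ := sInf (dirichletEigenvalues Ω)

end HypDirichlet

end

/-!
The first eigenvalue is controlled by a Sobolev inequality, and its existence by compactness.

If `f` is a `C¹` function with compact support in the upper half-plane, then `|f(x, y)|` is at most
the integral of `|∂ₓf|` along the horizontal line through the point, and `|f(x, y)| / y` is at most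
the integral of `|∂_y f| / t` along the vertical line, because `1 / y ≤ 1 / t` below the point. The
product of the two bounds integrates to `∫ f² dVol ≤ (∫ |∇f| dVol)²`
(`lintegral_sq_le_sq_lintegral_grad`). For `f = φ²`, the Cauchy–Schwarz inequality turns this into
`(∫_A φ²)² ≤ 4 Vol(A ∩ Ω) ∫ φ² ∫ |∇φ|²` for all test functions `φ` on `Ω` and all `A`
(`IsTestFunction.sq_setLIntegral_sq_le`). With `A = ℍ` and after passing to the closure `H¹₀(Ω)`,
this says that every eigenvalue is at least `1 / (4 Vol(Ω))`, whatever the size of `Vol(Ω)`.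

The same inequality gives the tightness needed for Rellich's theorem on domains of finite area,
bounded or not. Tile the plane by congruent squares of side about `κ`. On each tile a test function
is within `2κ` times the `L²` norm of its gradient from a constant
(`exists_setLIntegral_sub_const_le`), and all but finitely many tiles meet `Ω` in a set `A ∩ Ω` of
small area, which carries little mass. So the unit ball of `H¹₀(Ω)` is uniformly close in `L²` to
finite-dimensional spaces (`exists_finiteDimensional_approx`), and the inclusion `ι` of `H¹₀(Ω)`
into `L²` is compact (`isCompactOperator_H10Inclusion`). A compact operator attains its norm, and a
maximizer `u` satisfies `⟨ιu, ιv⟩ = ‖ι‖² ⟨u, v⟩_{H¹}` for all `v`, which is the weak eigenvalue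
equation for `μ = ‖ι‖⁻² - 1`. No eigenvalue is smaller, since an eigenfunction `v` for `μ'` has
`‖v‖²_{H¹} = (1 + μ') ‖v‖²_{L²}`.
-/

noncomputable section

namespace HypDirichlet

open scoped ENNReal

/-! ### Hyperbolic integrals in Cartesian coordinates -/

lemma measurable_complex_mk : Measurable fun p : ℝ × ℝ ↦ (⟨p.1, p.2⟩ : ℂ) :=
  Complex.measurableEquivRealProd.symm.measurable

lemma lintegral_complex (G : ℂ → ℝ≥0∞) (hG : Measurable G) :
    ∫⁻ z, G z = ∫⁻ y : ℝ, ∫⁻ x : ℝ, G ⟨x, y⟩ := by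
  rw [← (Complex.volume_preserving_equiv_real_prod.symm _).lintegral_comp hG]
  exact lintegral_prod_symm _ (hG.comp measurable_complex_mk).aemeasurable

lemma lintegral_upperHalfPlane (G : ℂ → ℝ≥0∞) (hG : Measurable G) :
    ∫⁻ z : ℍ, G z = ∫⁻ z : ℂ in {z | 0 < z.im}, G z * ‖z.im⁻¹‖ₑ ^ 2 := by
  have hd : Measurable fun z : ℂ ↦ ‖z.im⁻¹‖ₑ ^ 2 :=
    ((Complex.measurable_im.inv).enorm).pow_const 2
  have hdens : ∀ z : ℍ, ((((1 / NNReal.mk z.im z.im_pos.le : NNReal)) ^ 2 : NNReal) : ℝ≥0∞)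
      = ‖(z : ℂ).im⁻¹‖ₑ ^ 2 := by
    intro z
    change _ = ‖z.im⁻¹‖ₑ ^ 2
    rw [ENNReal.coe_pow, Real.enorm_eq_ofReal (inv_nonneg.2 z.im_pos.le), ENNReal.ofReal, one_div]
    congr 2
    ext
    simp [z.im_pos.le]
  rw [UpperHalfPlane.volume_def]
  simp_rw [hdens]
  rw [lintegral_withDensity_eq_lintegral_mul _ (f := fun z : ℍ ↦ ‖(z : ℂ).im⁻¹‖ₑ ^ 2)
    (hd.comp UpperHalfPlane.measurable_coe) (g := fun z : ℍ ↦ G z)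
    (hG.comp UpperHalfPlane.measurable_coe)]
  have hr : {z : ℂ | 0 < z.im} = range UpperHalfPlane.coe := by
    ext z
    exact ⟨fun h ↦ ⟨⟨z, h⟩, rfl⟩, by rintro ⟨w, rfl⟩; exact w.im_pos⟩
  rw [hr, ← UpperHalfPlane.measurableEmbedding_coe.map_comap,
    UpperHalfPlane.measurableEmbedding_coe.lintegral_map]
  simp [mul_comm]

/-- The hyperbolic integral over a Cartesian product `I × J`, by Tonelli. -/
lemma setLIntegral_prod_upperHalfPlane {I J : Set ℝ} (hI : MeasurableSet I) (hJ : MeasurableSet J)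
    (hJ0 : J ⊆ Ioi 0) (G : ℂ → ℝ≥0∞) (hG : Measurable G) :
    ∫⁻ z : ℍ in {z | z.re ∈ I ∧ z.im ∈ J}, G z
      = ∫⁻ y in J, ∫⁻ x in I, G ⟨x, y⟩ * ‖y⁻¹‖ₑ ^ 2 := by
  have hS : MeasurableSet {z : ℂ | z.re ∈ I ∧ z.im ∈ J} :=
    (Complex.measurable_re hI).inter (Complex.measurable_im hJ)
  have hS' : MeasurableSet {z : ℍ | z.re ∈ I ∧ z.im ∈ J} := UpperHalfPlane.measurable_coe hS
  have hP : MeasurableSet {z : ℂ | 0 < z.im} := Complex.measurable_im measurableSet_Ioi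
  have hd : Measurable fun z : ℂ ↦ ‖z.im⁻¹‖ₑ ^ 2 :=
    ((Complex.measurable_im.inv).enorm).pow_const 2
  rw [← lintegral_indicator hS']
  have h1 := lintegral_upperHalfPlane ({z : ℂ | z.re ∈ I ∧ z.im ∈ J}.indicator G)
    (hG.indicator hS)
  have h2 : ∀ z : ℍ, {z : ℂ | z.re ∈ I ∧ z.im ∈ J}.indicator G z
      = {z : ℍ | z.re ∈ I ∧ z.im ∈ J}.indicator (fun z : ℍ ↦ G z) z := fun z ↦ by
    simp only [indicator, mem_ofPred_eq]; rfl
  simp_rw [h2] at h1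
  have hm : Measurable fun z ↦ {z : ℂ | z.re ∈ I ∧ z.im ∈ J}.indicator G z * ‖z.im⁻¹‖ₑ ^ 2 :=
    (hG.indicator hS).mul hd
  rw [h1, ← lintegral_indicator hP, lintegral_complex _ (hm.indicator hP),
    ← lintegral_indicator hJ]
  congr 1 with y
  by_cases hy : y ∈ J
  · have hy0 : 0 < y := hJ0 hy
    rw [indicator_of_mem hy, ← lintegral_indicator hI]
    congr 1 with x
    by_cases hx : x ∈ I <;> simp [indicator, hx, hy, hy0]
  · simp [indicator, hy]

lemma lintegral_upperHalfPlane_iterated (G : ℂ → ℝ≥0∞) (hG : Measurable G) :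
    ∫⁻ z : ℍ, G z = ∫⁻ y in Ioi 0, ∫⁻ x : ℝ, G ⟨x, y⟩ * ‖y⁻¹‖ₑ ^ 2 := by
  have h := setLIntegral_prod_upperHalfPlane MeasurableSet.univ measurableSet_Ioi subset_rfl G hG
  have hu : {z : ℍ | z.re ∈ (univ : Set ℝ) ∧ z.im ∈ Ioi (0 : ℝ)} = univ := by
    ext z; simp [z.im_pos]
  rw [hu] at h
  simpa using h

/-! ### Differences along coordinate lines -/

lemma contDiff_horizontal {f : ℂ → ℝ} (hf : ContDiff ℝ 1 f) (y : ℝ) :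
    ContDiff ℝ 1 fun x : ℝ ↦ f ⟨x, y⟩ := by
  have h : (fun x : ℝ ↦ f ⟨x, y⟩) = fun x : ℝ ↦ f ((x : ℂ) + y * Complex.I) := by
    ext x; rw [Complex.mk_eq_add_mul_I]
  rw [h]
  exact hf.comp (Complex.ofRealCLM.contDiff.add contDiff_const)

lemma contDiff_vertical {f : ℂ → ℝ} (hf : ContDiff ℝ 1 f) (x : ℝ) :
    ContDiff ℝ 1 fun y : ℝ ↦ f ⟨x, y⟩ := by
  have h : (fun y : ℝ ↦ f ⟨x, y⟩) = fun y : ℝ ↦ f ((x : ℂ) + y * Complex.I) := by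
    ext y; rw [Complex.mk_eq_add_mul_I]
  rw [h]
  exact hf.comp (contDiff_const.add (Complex.ofRealCLM.contDiff.mul contDiff_const))

lemma enorm_deriv_horizontal_le {f : ℂ → ℝ} (hf : ContDiff ℝ 1 f) (x y : ℝ) :
    ‖deriv (fun x : ℝ ↦ f ⟨x, y⟩) x‖ₑ ≤ ‖fderiv ℝ f ⟨x, y⟩‖ₑ := by
  have h1 : HasDerivAt (fun x : ℝ ↦ (⟨x, y⟩ : ℂ)) 1 x := by
    have : (fun x : ℝ ↦ (⟨x, y⟩ : ℂ)) = fun x : ℝ ↦ (x : ℂ) + y * Complex.I := by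
      ext x; rw [Complex.mk_eq_add_mul_I]
    rw [this]
    exact (Complex.ofRealCLM.hasDerivAt (x := x)).add_const _
  have h2 := ((hf.differentiable one_ne_zero ⟨x, y⟩).hasFDerivAt.comp_hasDerivAt x h1).deriv
  rw [show (fun x : ℝ ↦ f ⟨x, y⟩) = f ∘ fun x : ℝ ↦ (⟨x, y⟩ : ℂ) from rfl, h2]
  simpa using (fderiv ℝ f ⟨x, y⟩).le_opENorm 1

lemma enorm_deriv_vertical_le {f : ℂ → ℝ} (hf : ContDiff ℝ 1 f) (x y : ℝ) :
    ‖deriv (fun y : ℝ ↦ f ⟨x, y⟩) y‖ₑ ≤ ‖fderiv ℝ f ⟨x, y⟩‖ₑ := by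
  have h1 : HasDerivAt (fun y : ℝ ↦ (⟨x, y⟩ : ℂ)) Complex.I y := by
    have : (fun y : ℝ ↦ (⟨x, y⟩ : ℂ)) = fun y : ℝ ↦ (x : ℂ) + y * Complex.I := by
      ext x; rw [Complex.mk_eq_add_mul_I]
    rw [this]
    simpa using ((Complex.ofRealCLM.hasDerivAt (x := y)).mul_const Complex.I).const_add (x : ℂ)
  have h2 := ((hf.differentiable one_ne_zero ⟨x, y⟩).hasFDerivAt.comp_hasDerivAt y h1).deriv
  rw [show (fun y : ℝ ↦ f ⟨x, y⟩) = f ∘ fun y : ℝ ↦ (⟨x, y⟩ : ℂ) from rfl, h2]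
  simpa [← ofReal_norm] using (fderiv ℝ f ⟨x, y⟩).le_opENorm Complex.I

lemma enorm_sub_le_of_mem_Ico {h : ℝ → ℝ} {D : ℝ → ℝ≥0∞} (hh : ContDiff ℝ 1 h)
    (hD : ∀ t, ‖deriv h t‖ₑ ≤ D t) {a b u v : ℝ} (hu : u ∈ Ico a b) (hv : v ∈ Ico a b) :
    ‖h u - h v‖ₑ ≤ ∫⁻ t in Ico a b, D t := by
  wlog huv : v ≤ u generalizing u v
  · rw [← enorm_neg, neg_sub]
    exact this hv hu (le_of_not_ge huv)
  calc ‖h u - h v‖ₑ ≤ ∫⁻ t in Icc v u, ‖deriv h t‖ₑ :=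
        enorm_sub_le_lintegral_deriv_of_contDiffOn_Icc hh.contDiffOn huv
    _ ≤ ∫⁻ t in Ico a b, ‖deriv h t‖ₑ :=
        lintegral_mono_set fun t ht ↦ ⟨hv.1.trans ht.1, ht.2.trans_lt hu.2⟩
    _ ≤ _ := lintegral_mono hD

/-- The Cauchy–Schwarz inequality, without square roots. -/
lemma sq_lintegral_mul_le {α : Type*} [MeasurableSpace α] (μ : Measure α) {f g : α → ℝ≥0∞}
    (hf : AEMeasurable f μ) (hg : AEMeasurable g μ) :
    (∫⁻ a, f a * g a ∂μ) ^ 2 ≤ (∫⁻ a, f a ^ 2 ∂μ) * ∫⁻ a, g a ^ 2 ∂μ := by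
  have h := ENNReal.lintegral_mul_le_Lp_mul_Lq μ Real.HolderConjugate.two_two hf hg
  simp only [Pi.mul_apply, ENNReal.rpow_ofNat] at h
  calc _ ≤ ((∫⁻ a, f a ^ 2 ∂μ) ^ (1 / 2 : ℝ) * (∫⁻ a, g a ^ 2 ∂μ) ^ (1 / 2 : ℝ)) ^ 2 := by gcongr
    _ = _ := by
      rw [mul_pow, ← ENNReal.rpow_natCast, ← ENNReal.rpow_natCast, ← ENNReal.rpow_mul,
        ← ENNReal.rpow_mul]
      norm_num

lemma sq_setLIntegral_le {α : Type*} [MeasurableSpace α] (μ : Measure α) {f : α → ℝ≥0∞}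
    (hf : AEMeasurable f μ) (s : Set α) :
    (∫⁻ a in s, f a ∂μ) ^ 2 ≤ μ s * ∫⁻ a in s, f a ^ 2 ∂μ := by
  have h := sq_lintegral_mul_le (μ.restrict s) (aemeasurable_const (b := (1 : ℝ≥0∞)))
    (hf.mono_measure Measure.restrict_le_self)
  simpa using h

/-! ### The `L¹` Sobolev inequality of the hyperbolic plane -/

lemma measurable_enorm_fderiv {f : ℂ → ℝ} (hf : ContDiff ℝ 1 f) :
    Measurable fun z ↦ ‖fderiv ℝ f z‖ₑ :=
  (hf.continuous_fderiv one_ne_zero).enorm.measurable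

lemma enorm_le_lintegral_horizontal {f : ℂ → ℝ} (hf : ContDiff ℝ 1 f) (hc : HasCompactSupport f)
    (x y : ℝ) : ‖f ⟨x, y⟩‖ₑ ≤ ∫⁻ s : ℝ, ‖fderiv ℝ f ⟨s, y⟩‖ₑ := by
  obtain ⟨r, hr⟩ := hc.isCompact.isBounded.subset_closedBall 0
  have hz : f ⟨-(|r| + |x| + 1), y⟩ = 0 := by
    by_contra h
    have h1 : ‖(⟨-(|r| + |x| + 1), y⟩ : ℂ)‖ ≤ r := by
      simpa using hr (subset_tsupport f h)
    have h2 := (Complex.abs_re_le_norm ⟨-(|r| + |x| + 1), y⟩).trans h1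
    rw [abs_neg, abs_of_nonneg (by positivity)] at h2
    linarith [le_abs_self r, abs_nonneg x]
  have h := enorm_sub_le_of_mem_Ico (h := fun x ↦ f ⟨x, y⟩) (contDiff_horizontal hf y)
    (enorm_deriv_horizontal_le hf · y) (a := -(|r| + |x| + 1)) (b := x + 1)
    (u := x) (v := -(|r| + |x| + 1))
    ⟨by linarith [neg_abs_le x, abs_nonneg r], by linarith⟩
    ⟨le_rfl, by linarith [neg_abs_le x, abs_nonneg r]⟩
  simp only [hz, sub_zero] at h
  exact h.trans (setLIntegral_le_lintegral _ _)

/-- The factor `1 / y` is bounded by `1 / t` along the segment `0 < t ≤ y` below the point. -/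
lemma enorm_mul_inv_le_lintegral_vertical {f : ℂ → ℝ} (hf : ContDiff ℝ 1 f)
    (hs : tsupport f ⊆ {z | 0 < z.im}) (x : ℝ) {y : ℝ} (hy : 0 < y) :
    ‖f ⟨x, y⟩‖ₑ * ‖y⁻¹‖ₑ ≤ ∫⁻ t in Ioi 0, ‖fderiv ℝ f ⟨x, t⟩‖ₑ * ‖t⁻¹‖ₑ := by
  have hz : f ⟨x, 0⟩ = 0 := by
    by_contra h
    exact lt_irrefl (0 : ℝ) (hs (subset_tsupport f h))
  have h := enorm_sub_le_lintegral_deriv_of_contDiffOn_Icc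
    (f := fun t ↦ f ⟨x, t⟩) (contDiff_vertical hf x).contDiffOn hy.le
  simp only [hz, sub_zero] at h
  calc ‖f ⟨x, y⟩‖ₑ * ‖y⁻¹‖ₑ
      ≤ (∫⁻ t in Icc 0 y, ‖deriv (fun t ↦ f ⟨x, t⟩) t‖ₑ) * ‖y⁻¹‖ₑ := by gcongr
    _ = (∫⁻ t in Ioc 0 y, ‖deriv (fun t ↦ f ⟨x, t⟩) t‖ₑ) * ‖y⁻¹‖ₑ := by
        rw [setLIntegral_congr Ioc_ae_eq_Icc]
    _ = ∫⁻ t in Ioc 0 y, ‖deriv (fun t ↦ f ⟨x, t⟩) t‖ₑ * ‖y⁻¹‖ₑ :=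
        (lintegral_mul_const' _ _ enorm_ne_top).symm
    _ ≤ ∫⁻ t in Ioc 0 y, ‖fderiv ℝ f ⟨x, t⟩‖ₑ * ‖t⁻¹‖ₑ := by
        refine setLIntegral_mono' measurableSet_Ioc fun t ht ↦ ?_
        have h0 : 0 < t := ht.1
        gcongr
        · exact enorm_deriv_vertical_le hf x t
        · rw [Real.enorm_eq_ofReal (inv_nonneg.2 hy.le), Real.enorm_eq_ofReal (inv_nonneg.2 h0.le)]
          gcongr
          exact ht.2
    _ ≤ _ := lintegral_mono_set fun t ht ↦ ht.1

/-- The `L¹` Sobolev (isoperimetric) inequality of the hyperbolic plane, with a non-sharp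
constant, in the manner of Gagliardo and Nirenberg: `f(x, y)² / y²` is at most a function of `y`
times a function of `x`, and both have the hyperbolic `L¹` norm of the gradient as integral. -/
theorem lintegral_sq_le_sq_lintegral_grad {f : ℂ → ℝ} (hf : ContDiff ℝ 1 f)
    (hc : HasCompactSupport f) (hs : tsupport f ⊆ {z | 0 < z.im}) :
    ∫⁻ z : ℍ, ‖f z‖ₑ ^ 2 ≤ (∫⁻ z : ℍ, ‖z.im‖ₑ * ‖fderiv ℝ f z‖ₑ) ^ 2 := by
  have hD := measurable_enorm_fderiv hf
  set A : ℝ → ℝ≥0∞ := fun y ↦ ∫⁻ s : ℝ, ‖fderiv ℝ f ⟨s, y⟩‖ₑ with hA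
  set B : ℝ → ℝ≥0∞ := fun x ↦ ∫⁻ t in Ioi 0, ‖fderiv ℝ f ⟨x, t⟩‖ₑ * ‖t⁻¹‖ₑ with hB
  have hDp : Measurable fun p : ℝ × ℝ ↦ ‖fderiv ℝ f ⟨p.1, p.2⟩‖ₑ * ‖p.2⁻¹‖ₑ :=
    (hD.comp measurable_complex_mk).mul measurable_snd.inv.enorm
  have hBm : Measurable B := hDp.lintegral_prod_right'
  have hAm : Measurable A := (hD.comp measurable_complex_mk).lintegral_prod_left'
  have hgrad : ∫⁻ z : ℍ, ‖z.im‖ₑ * ‖fderiv ℝ f z‖ₑ = ∫⁻ y in Ioi 0, A y * ‖y⁻¹‖ₑ := by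
    have h := lintegral_upperHalfPlane_iterated (fun z ↦ ‖z.im‖ₑ * ‖fderiv ℝ f z‖ₑ)
      (Complex.measurable_im.enorm.mul hD)
    refine h.trans (setLIntegral_congr_fun measurableSet_Ioi fun y hy ↦ ?_)
    rw [hA, ← lintegral_mul_const' _ _ enorm_ne_top]
    congr 1 with x
    have hy' : y ≠ 0 := ne_of_gt hy
    have h1 : ‖y‖ₑ * ‖y⁻¹‖ₑ = 1 := by rw [← enorm_mul, mul_inv_cancel₀ hy']; simp
    calc ‖y‖ₑ * ‖fderiv ℝ f ⟨x, y⟩‖ₑ * ‖y⁻¹‖ₑ ^ 2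
        = (‖y‖ₑ * ‖y⁻¹‖ₑ) * (‖fderiv ℝ f ⟨x, y⟩‖ₑ * ‖y⁻¹‖ₑ) := by ring
      _ = _ := by rw [h1, one_mul]
  have hAB : ∫⁻ y in Ioi 0, A y * ‖y⁻¹‖ₑ = ∫⁻ x, B x := by
    simp_rw [hA, hB, ← lintegral_mul_const' _ _ enorm_ne_top]
    exact (lintegral_lintegral_swap hDp.aemeasurable).symm
  rw [lintegral_upperHalfPlane_iterated (fun z ↦ ‖f z‖ₑ ^ 2)
    (hf.continuous.enorm.measurable.pow_const 2)]
  calc ∫⁻ y in Ioi 0, ∫⁻ x : ℝ, ‖f ⟨x, y⟩‖ₑ ^ 2 * ‖y⁻¹‖ₑ ^ 2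
      ≤ ∫⁻ y in Ioi 0, ∫⁻ x : ℝ, (A y * ‖y⁻¹‖ₑ) * B x := by
        refine setLIntegral_mono' measurableSet_Ioi fun y hy ↦ lintegral_mono fun x ↦ ?_
        calc ‖f ⟨x, y⟩‖ₑ ^ 2 * ‖y⁻¹‖ₑ ^ 2
            = (‖f ⟨x, y⟩‖ₑ * ‖y⁻¹‖ₑ) * (‖f ⟨x, y⟩‖ₑ * ‖y⁻¹‖ₑ) := by ring
          _ ≤ (A y * ‖y⁻¹‖ₑ) * B x := by
            gcongr
            · exact enorm_le_lintegral_horizontal hf hc x y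
            · exact enorm_mul_inv_le_lintegral_vertical hf hs x hy
    _ = (∫⁻ y in Ioi 0, A y * ‖y⁻¹‖ₑ) * ∫⁻ x, B x := by
        simp_rw [lintegral_const_mul _ hBm]
        exact lintegral_mul_const _ (hAm.mul measurable_inv.enorm)
    _ = _ := by rw [hgrad, ← hAB, sq]

/-! ### Consequences for test functions -/

lemma enorm_hypGrad (φ : ℂ → ℝ) (z : ℍ) : ‖hypGrad φ z‖ₑ = ‖z.im‖ₑ * ‖fderiv ℝ φ z‖ₑ := by
  simp [hypGrad, gradient, ← ofReal_norm]

lemma IsTestFunction.contDiff_one {Ω : Set ℍ} {φ : ℂ → ℝ} (h : IsTestFunction Ω φ) :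
    ContDiff ℝ 1 φ := h.contDiff.of_le (by norm_cast)

lemma IsTestFunction.tsupport_subset_im_pos {Ω : Set ℍ} {φ : ℂ → ℝ} (h : IsTestFunction Ω φ) :
    tsupport φ ⊆ {z | 0 < z.im} := fun z hz ↦ by
  obtain ⟨w, -, rfl⟩ := h.tsupport_subset hz
  exact w.im_pos

lemma IsTestFunction.eq_zero_of_notMem {Ω : Set ℍ} {φ : ℂ → ℝ} (h : IsTestFunction Ω φ) {z : ℍ}
    (hz : z ∉ Ω) : φ z = 0 := by
  by_contra h0
  obtain ⟨w, hw, hwz⟩ := h.tsupport_subset (subset_tsupport φ h0)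
  exact hz (UpperHalfPlane.ext hwz ▸ hw)

lemma IsTestFunction.continuous_hypGrad {Ω : Set ℍ} {φ : ℂ → ℝ} (h : IsTestFunction Ω φ) :
    Continuous (hypGrad φ) := by
  have h1 : Continuous fun z : ℍ ↦ fderiv ℝ φ z :=
    (h.contDiff_one.continuous_fderiv one_ne_zero).comp UpperHalfPlane.continuous_coe
  exact UpperHalfPlane.continuous_im.smul ((LinearIsometryEquiv.continuous _).comp h1)

lemma IsTestFunction.continuous_comp_coe {Ω : Set ℍ} {φ : ℂ → ℝ} (h : IsTestFunction Ω φ) :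
    Continuous fun z : ℍ ↦ φ z :=
  h.contDiff.continuous.comp UpperHalfPlane.continuous_coe

/-- The Sobolev inequality for `φ²`: the `L²` mass of a test function in `A` is controlled by the
volume of `A ∩ Ω`. For `A = ℍ` this is the Faber–Krahn inequality, and for the complement of a
large set it shows that no mass escapes to infinity. -/
theorem IsTestFunction.sq_setLIntegral_sq_le {Ω : Set ℍ} (hΩ : MeasurableSet Ω) {φ : ℂ → ℝ}
    (h : IsTestFunction Ω φ) (A : Set ℍ) :
    (∫⁻ z : ℍ in A, ‖φ z‖ₑ ^ 2) ^ 2 ≤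
      4 * volume (A ∩ Ω) * ((∫⁻ z : ℍ, ‖φ z‖ₑ ^ 2) * ∫⁻ z : ℍ, ‖hypGrad φ z‖ₑ ^ 2) := by
  have hφm : Measurable fun z : ℍ ↦ ‖φ z‖ₑ := h.continuous_comp_coe.enorm.measurable
  have hgm : Measurable fun z : ℍ ↦ ‖hypGrad φ z‖ₑ := h.continuous_hypGrad.enorm.measurable
  have hsub : tsupport (fun z ↦ φ z ^ 2) ⊆ tsupport φ :=
    closure_mono fun z hz h0 ↦ hz (by simp [h0])
  have hsob := lintegral_sq_le_sq_lintegral_grad (f := fun z ↦ φ z ^ 2) (h.contDiff_one.pow 2)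
    (h.hasCompactSupport.of_isClosed_subset (isClosed_tsupport _) hsub)
    (hsub.trans h.tsupport_subset_im_pos)
  have hderiv : ∀ z : ℍ, ‖z.im‖ₑ * ‖fderiv ℝ (fun z ↦ φ z ^ 2) z‖ₑ
      = 2 * (‖φ z‖ₑ * ‖hypGrad φ z‖ₑ) := by
    intro z
    have h1 := ((h.contDiff_one.differentiable one_ne_zero (z : ℂ)).hasFDerivAt.pow 2).fderiv
    rw [enorm_hypGrad, h1]
    rw [enorm_smul, Nat.add_one_sub_one, pow_one, nsmul_eq_mul, enorm_mul,
      show ‖((2 : ℕ) : ℝ)‖ₑ = 2 by simp [← ofReal_norm]]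
    ring
  have hm : Measurable fun z : ℍ ↦ ‖φ z‖ₑ * ‖hypGrad φ z‖ₑ := hφm.mul hgm
  simp_rw [hderiv] at hsob
  rw [lintegral_const_mul 2 hm, mul_pow] at hsob
  have hAΩ : ∫⁻ z : ℍ in A, ‖φ z‖ₑ ^ 2 = ∫⁻ z : ℍ in A ∩ Ω, ‖φ z‖ₑ ^ 2 := by
    rw [inter_comm, ← Measure.restrict_restrict hΩ, ← lintegral_indicator hΩ]
    congr 1 with z
    by_cases hz : z ∈ Ω
    · simp [hz]
    · simp [hz, h.eq_zero_of_notMem hz]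
  calc (∫⁻ z : ℍ in A, ‖φ z‖ₑ ^ 2) ^ 2
      ≤ volume (A ∩ Ω) * ∫⁻ z : ℍ in A ∩ Ω, (‖φ z‖ₑ ^ 2) ^ 2 := by
        rw [hAΩ]
        exact sq_setLIntegral_le _ (hφm.pow_const 2).aemeasurable _
    _ ≤ volume (A ∩ Ω) * ∫⁻ z : ℍ, ‖φ z ^ 2‖ₑ ^ 2 := by
        simp_rw [enorm_pow]
        gcongr
        exact Measure.restrict_le_self
    _ ≤ volume (A ∩ Ω) * (2 ^ 2 * ((∫⁻ z : ℍ, ‖φ z‖ₑ ^ 2) * ∫⁻ z : ℍ, ‖hypGrad φ z‖ₑ ^ 2)) := by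
        gcongr
        refine hsob.trans ?_
        gcongr
        exact sq_lintegral_mul_le _ hφm.aemeasurable hgm.aemeasurable
    _ = _ := by ring

/-! ### The Poincaré inequality on a tile -/

/-- On the square `[a, a + κb) × [b, b + κb)`, whose hyperbolic shape does not depend on `a` and
`b`, a function is close to one of its values in the mean. -/
theorem exists_setLIntegral_sub_const_le {f : ℂ → ℝ} (hf : ContDiff ℝ 1 f) {κ : ℝ} (hκ : 0 < κ)
    (a : ℝ) {b : ℝ} (hb : 0 < b) :
    ∃ c : ℝ, ∫⁻ z : ℍ in {z | z.re ∈ Ico a (a + κ * b) ∧ z.im ∈ Ico b (b + κ * b)},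
        ‖f z - c‖ₑ ^ 2
      ≤ ENNReal.ofReal (4 * κ ^ 2) *
        ∫⁻ z : ℍ in {z | z.re ∈ Ico a (a + κ * b) ∧ z.im ∈ Ico b (b + κ * b)},
          (‖z.im‖ₑ * ‖fderiv ℝ f z‖ₑ) ^ 2 := by
  set δ := κ * b with hδ
  have hδ0 : 0 < δ := mul_pos hκ hb
  set I := Ico a (a + δ)
  set J := Ico b (b + δ)
  set d : ℝ≥0∞ := ENNReal.ofReal δ with hd
  have hd0 : d ≠ 0 := by simpa [hd] using hδ0
  have hdt : d ≠ ⊤ := ENNReal.ofReal_ne_top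
  have hI : volume I = d := by simp [I, hd]
  have hJ : volume J = d := by simp [J, hd]
  have hJ0 : J ⊆ Ioi 0 := fun y hy ↦ hb.trans_le hy.1
  have hD := measurable_enorm_fderiv hf
  have hDh : ∀ y, Measurable fun s : ℝ ↦ ‖fderiv ℝ f ⟨s, y⟩‖ₑ := fun y ↦
    hD.comp (measurable_complex_mk.comp (measurable_id.prodMk measurable_const))
  have hDv : ∀ x, Measurable fun t : ℝ ↦ ‖fderiv ℝ f ⟨x, t⟩‖ₑ := fun x ↦
    hD.comp (measurable_complex_mk.comp (measurable_const.prodMk measurable_id))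
  have hD2 : Measurable fun p : ℝ × ℝ ↦ ‖fderiv ℝ f ⟨p.1, p.2⟩‖ₑ ^ 2 :=
    (hD.comp measurable_complex_mk).pow_const 2
  set E : ℝ≥0∞ := ∫⁻ y in J, ∫⁻ x in I, ‖fderiv ℝ f ⟨x, y⟩‖ₑ ^ 2 with hE
  -- the vertical side `x = x'` is chosen to carry at most the average of the energy
  obtain ⟨x', hx', hx'E⟩ : ∃ x' ∈ I, ∫⁻ t in J, ‖fderiv ℝ f ⟨x', t⟩‖ₑ ^ 2 ≤ d⁻¹ * E := by
    obtain ⟨x', hx', h⟩ := exists_le_setLAverage (μ := (volume : Measure ℝ)) (s := I)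
      (f := fun x ↦ ∫⁻ t in J, ‖fderiv ℝ f ⟨x, t⟩‖ₑ ^ 2) (by rw [hI]; exact hd0)
      (by rw [hI]; exact hdt) hD2.lintegral_prod_right'.aemeasurable
    refine ⟨x', hx', h.trans_eq ?_⟩
    rw [setLAverage_eq, hI, lintegral_lintegral_swap hD2.aemeasurable, ENNReal.div_eq_inv_mul]
  have hbJ : b ∈ J := ⟨le_rfl, by linarith⟩
  refine ⟨f ⟨x', b⟩, ?_⟩
  have hpt : ∀ x ∈ I, ∀ y ∈ J, ‖f ⟨x, y⟩ - f ⟨x', b⟩‖ₑ ^ 2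
      ≤ 2 * (d * ∫⁻ s in I, ‖fderiv ℝ f ⟨s, y⟩‖ₑ ^ 2) + 2 * E := by
    intro x hx y hy
    have h1 := enorm_sub_le_of_mem_Ico (h := fun x ↦ f ⟨x, y⟩) (contDiff_horizontal hf y)
      (enorm_deriv_horizontal_le hf · y) hx hx'
    have h2 := enorm_sub_le_of_mem_Ico (h := fun y ↦ f ⟨x', y⟩) (contDiff_vertical hf x')
      (enorm_deriv_vertical_le hf x' ·) hy hbJ
    have h1' := (pow_le_pow_left' h1 2).trans (sq_setLIntegral_le _ (hDh y).aemeasurable _)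
    have h2' := (pow_le_pow_left' h2 2).trans (sq_setLIntegral_le _ (hDv x').aemeasurable _)
    rw [show Ico a (a + δ) = I from rfl, hI] at h1'
    rw [show Ico b (b + δ) = J from rfl, hJ] at h2'
    have h3 : d * ∫⁻ t in J, ‖fderiv ℝ f ⟨x', t⟩‖ₑ ^ 2 ≤ E := by
      calc _ ≤ d * (d⁻¹ * E) := by gcongr
        _ = E := by rw [← mul_assoc, ENNReal.mul_inv_cancel hd0 hdt, one_mul]
    calc ‖f ⟨x, y⟩ - f ⟨x', b⟩‖ₑ ^ 2
        = ‖(f ⟨x, y⟩ - f ⟨x', y⟩) + (f ⟨x', y⟩ - f ⟨x', b⟩)‖ₑ ^ 2 := by ring_nf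
      _ ≤ (‖f ⟨x, y⟩ - f ⟨x', y⟩‖ₑ + ‖f ⟨x', y⟩ - f ⟨x', b⟩‖ₑ) ^ 2 := by
          gcongr
          exact enorm_add_le _ _
      _ ≤ 2 * ‖f ⟨x, y⟩ - f ⟨x', y⟩‖ₑ ^ 2 + 2 * ‖f ⟨x', y⟩ - f ⟨x', b⟩‖ₑ ^ 2 := by
          have h4 := ENNReal.rpow_add_le_mul_rpow_add_rpow ‖f ⟨x, y⟩ - f ⟨x', y⟩‖ₑ
            ‖f ⟨x', y⟩ - f ⟨x', b⟩‖ₑ one_le_two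
          norm_num at h4
          rwa [mul_add] at h4
      _ ≤ _ := by gcongr; exact h2'.trans h3
  have hEuc : ∫⁻ y in J, ∫⁻ x in I, ‖f ⟨x, y⟩ - f ⟨x', b⟩‖ₑ ^ 2 ≤ 4 * d ^ 2 * E := by
    calc _ ≤ ∫⁻ y in J, ∫⁻ x in I, (2 * (d * ∫⁻ s in I, ‖fderiv ℝ f ⟨s, y⟩‖ₑ ^ 2) + 2 * E) :=
          setLIntegral_mono' measurableSet_Ico fun y hy ↦
            setLIntegral_mono' measurableSet_Ico fun x hx ↦ hpt x hx y hy
      _ = ∫⁻ y in J, (2 * d ^ 2 * (∫⁻ s in I, ‖fderiv ℝ f ⟨s, y⟩‖ₑ ^ 2) + 2 * d * E) := by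
          congr 1 with y
          rw [setLIntegral_const, hI]
          ring
      _ = 2 * d ^ 2 * E + 2 * d * E * d := by
          rw [lintegral_add_right _ measurable_const, setLIntegral_const, hJ,
            lintegral_const_mul _ hD2.lintegral_prod_left']
      _ = _ := by ring
  have hgrad : ∫⁻ z : ℍ in {z | z.re ∈ I ∧ z.im ∈ J}, (‖z.im‖ₑ * ‖fderiv ℝ f z‖ₑ) ^ 2
      = ∫⁻ y in J, ∫⁻ x in I, (‖y‖ₑ * ‖fderiv ℝ f ⟨x, y⟩‖ₑ) ^ 2 * ‖y⁻¹‖ₑ ^ 2 :=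
    setLIntegral_prod_upperHalfPlane measurableSet_Ico measurableSet_Ico hJ0
      (fun z ↦ (‖z.im‖ₑ * ‖fderiv ℝ f z‖ₑ) ^ 2)
      ((Complex.measurable_im.enorm.mul hD).pow_const 2)
  rw [hgrad, setLIntegral_prod_upperHalfPlane measurableSet_Ico measurableSet_Ico hJ0
      (fun z ↦ ‖f z - f ⟨x', b⟩‖ₑ ^ 2)
      ((hf.continuous.sub continuous_const).enorm.measurable.pow_const 2)]
  -- the Dirichlet integral is conformally invariant
  have hconf : ∫⁻ y in J, ∫⁻ x in I, (‖y‖ₑ * ‖fderiv ℝ f ⟨x, y⟩‖ₑ) ^ 2 * ‖y⁻¹‖ₑ ^ 2 = E := by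
    refine setLIntegral_congr_fun measurableSet_Ico fun y hy ↦ ?_
    congr 1 with x
    have hy' : y ≠ 0 := ne_of_gt (hJ0 hy)
    have h1 : ‖y‖ₑ * ‖y⁻¹‖ₑ = 1 := by rw [← enorm_mul, mul_inv_cancel₀ hy']; simp
    calc _ = (‖y‖ₑ * ‖y⁻¹‖ₑ) ^ 2 * ‖fderiv ℝ f ⟨x, y⟩‖ₑ ^ 2 := by ring
      _ = _ := by rw [h1]; ring
  rw [hconf]
  calc ∫⁻ y in J, ∫⁻ x in I, ‖f ⟨x, y⟩ - f ⟨x', b⟩‖ₑ ^ 2 * ‖y⁻¹‖ₑ ^ 2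
      ≤ ∫⁻ y in J, ∫⁻ x in I, ‖f ⟨x, y⟩ - f ⟨x', b⟩‖ₑ ^ 2 * ‖b⁻¹‖ₑ ^ 2 := by
        refine setLIntegral_mono' measurableSet_Ico fun y hy ↦ lintegral_mono fun x ↦ ?_
        gcongr _ * ?_ ^ 2
        have hy0 : 0 < y := hJ0 hy
        rw [Real.enorm_eq_ofReal (inv_nonneg.2 hy0.le), Real.enorm_eq_ofReal (inv_nonneg.2 hb.le)]
        gcongr
        exact hy.1
    _ = (∫⁻ y in J, ∫⁻ x in I, ‖f ⟨x, y⟩ - f ⟨x', b⟩‖ₑ ^ 2) * ‖b⁻¹‖ₑ ^ 2 := by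
        simp_rw [lintegral_mul_const' _ _ (ENNReal.pow_ne_top (enorm_ne_top (x := b⁻¹)))]
    _ ≤ 4 * d ^ 2 * E * ‖b⁻¹‖ₑ ^ 2 := by gcongr
    _ = 4 * (d * ‖b⁻¹‖ₑ) ^ 2 * E := by ring
    _ = ENNReal.ofReal (4 * κ ^ 2) * E := by
        rw [Real.enorm_eq_ofReal (inv_nonneg.2 hb.le), hd, ← ENNReal.ofReal_mul hδ0.le, hδ,
          mul_inv_cancel_right₀ hb.ne', ENNReal.ofReal_mul (by norm_num), ENNReal.ofReal_pow hκ.le]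
        norm_num

/-! ### Tilings of the hyperbolic plane -/

/-- The hyperbolic plane is tiled by countably many congruent squares, of side `κ` times the height
of the base. The tiles are given as the fibres of the map which labels a point by its tile. -/
theorem exists_tiling {κ : ℝ} (hκ : 0 < κ) :
    ∃ k : ℍ → ℤ × ℤ, Measurable k ∧ ∀ q, ∃ a b : ℝ, 0 < b ∧
      k ⁻¹' {q} = {z | z.re ∈ Ico a (a + κ * b) ∧ z.im ∈ Ico b (b + κ * b)} := by
  set L := Real.log (1 + κ) with hL
  have hL0 : 0 < L := Real.log_pos (by linarith)
  have hre : Measurable fun z : ℍ ↦ z.re := UpperHalfPlane.continuous_re.measurable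
  have him : Measurable fun z : ℍ ↦ z.im := UpperHalfPlane.continuous_im.measurable
  have hj : Measurable fun z : ℍ ↦ ⌊Real.log z.im / L⌋ :=
    ((Real.measurable_log.comp him).div_const L).floor
  have hj' : Measurable fun z : ℍ ↦ (⌊Real.log z.im / L⌋ : ℝ) :=
    (measurable_from_top (f := fun n : ℤ ↦ (n : ℝ))).comp hj
  refine ⟨fun z ↦ (⌊z.re / (κ * Real.exp (⌊Real.log z.im / L⌋ * L))⌋, ⌊Real.log z.im / L⌋),
    Measurable.prodMk ?_ hj, fun ⟨i, j⟩ ↦ ⟨i * (κ * Real.exp (j * L)), Real.exp (j * L),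
      Real.exp_pos _, ?_⟩⟩
  · exact (hre.div ((Real.measurable_exp.comp (hj'.mul_const L)).const_mul κ)).floor
  · ext z
    have hb : 0 < κ * Real.exp (j * L) := by positivity
    have h1 : ⌊Real.log z.im / L⌋ = j ↔
        z.im ∈ Ico (Real.exp (j * L)) (Real.exp (j * L) + κ * Real.exp (j * L)) := by
      rw [Int.floor_eq_iff, le_div_iff₀ hL0, div_lt_iff₀ hL0, Real.le_log_iff_exp_le z.im_pos,
        Real.log_lt_iff_lt_exp z.im_pos, add_mul, Real.exp_add, one_mul, hL,
        Real.exp_log (by linarith : 0 < 1 + κ), mem_Ico]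
      ring_nf
    have h2 : ⌊z.re / (κ * Real.exp (j * L))⌋ = i ↔
        z.re ∈ Ico (i * (κ * Real.exp (j * L)))
          (i * (κ * Real.exp (j * L)) + κ * Real.exp (j * L)) := by
      rw [Int.floor_eq_iff, le_div_iff₀ hb, div_lt_iff₀ hb, mem_Ico]
      ring_nf
    simp only [mem_preimage, mem_singleton_iff, Prod.mk.injEq, mem_ofPred_eq]
    rw [← h1, ← h2]
    constructor
    · rintro ⟨h3, h4⟩
      exact ⟨h4 ▸ h3, h4⟩
    · rintro ⟨h3, h4⟩
      exact ⟨h4.symm ▸ h3, h4⟩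

/-- Finitely many fibres of a map to a countable type exhaust a finite measure. -/
lemma exists_finset_measure_preimage_compl_le {α β : Type*} [MeasurableSpace α] [Countable β]
    [MeasurableSpace β] [MeasurableSingletonClass β] (μ : Measure α) [IsFiniteMeasure μ]
    {k : α → β} (hk : Measurable k) {ε : ℝ≥0∞} (hε : 0 < ε) :
    ∃ s : Finset β, μ (k ⁻¹' s)ᶜ ≤ ε := by
  have hm : ∀ t : Set β, ∑' b : t, μ (k ⁻¹' {(b : β)}) = μ (k ⁻¹' t) := fun t ↦
    tsum_measure_preimage_singleton t.to_countable fun y _ ↦ hk (measurableSet_singleton y)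
  have htop : ∑' b, μ (k ⁻¹' {b}) ≠ ⊤ := by
    rw [← tsum_univ (f := fun b ↦ μ (k ⁻¹' {b})), hm univ]
    exact measure_ne_top _ _
  obtain ⟨s, hs⟩ := ((ENNReal.tendsto_tsum_compl_atTop_zero htop).eventually
    (ge_mem_nhds hε)).exists
  exact ⟨s, by rw [← preimage_compl, ← hm]; exact hs⟩

/-! ### Approximation by step functions -/

lemma sq_enorm_eq_lintegral {α E : Type*} [MeasurableSpace α] {μ : Measure α}
    [NormedAddCommGroup E] (u : Lp E 2 μ) {f : α → E} (h : ∀ᵐ a ∂μ, u a = f a) :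
    ‖u‖ₑ ^ 2 = ∫⁻ a, ‖f a‖ₑ ^ 2 ∂μ := by
  have h2 := eLpNorm_nnreal_pow_eq_lintegral (μ := μ) (f := u) (p := 2) two_ne_zero
  rw [Lp.enorm_def]
  norm_num at h2
  rw [h2]
  exact lintegral_congr_ae (h.mono fun a ha ↦ by simp only [ha])

lemma enorm_sq_eq_ofReal {E : Type*} [NormedAddCommGroup E] (u : E) :
    ‖u‖ₑ ^ 2 = ENNReal.ofReal (‖u‖ ^ 2) := by
  rw [ENNReal.ofReal_pow (norm_nonneg _), ofReal_norm]

/-- A function which is constant on each of finitely many pieces is a linear combination of the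
indicators of the pieces. -/
lemma exists_mem_span_indicator {α ι : Type*} [MeasurableSpace α] {μ : Measure α} (s : Finset ι)
    {Q : ι → Set α} (hQ : ∀ i, MeasurableSet (Q i)) (hμQ : ∀ i, μ (Q i) ≠ ⊤) (c : ι → ℝ) :
    ∃ v ∈ Submodule.span ℝ
        ((fun i ↦ indicatorConstLp (2 : ℝ≥0∞) (hQ i) (hμQ i) (1 : ℝ)) '' (s : Set ι)),
      ∀ᵐ a ∂μ, v a = ∑ i ∈ s, c i * (Q i).indicator (fun _ ↦ 1) a := by
  refine ⟨∑ i ∈ s, c i • indicatorConstLp (2 : ℝ≥0∞) (hQ i) (hμQ i) (1 : ℝ),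
    Submodule.sum_mem _ fun i hi ↦ Submodule.smul_mem _ _
      (Submodule.subset_span (mem_image_of_mem _ hi)), ?_⟩
  classical
  induction s using Finset.induction_on with
  | empty =>
    filter_upwards [Lp.coeFn_zero ℝ 2 μ] with a ha
    simpa using ha
  | insert i s hi ih =>
    rw [Finset.sum_insert hi]
    filter_upwards [ih, Lp.coeFn_add (c i • indicatorConstLp (2 : ℝ≥0∞) (hQ i) (hμQ i) (1 : ℝ))
      (∑ i ∈ s, c i • indicatorConstLp (2 : ℝ≥0∞) (hQ i) (hμQ i) (1 : ℝ)),
      Lp.coeFn_smul (c i) (indicatorConstLp (2 : ℝ≥0∞) (hQ i) (hμQ i) (1 : ℝ)),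
      indicatorConstLp_coeFn (p := 2) (hs := hQ i) (hμs := hμQ i) (c := (1 : ℝ))]
      with a h1 h2 h3 h4
    rw [h2, Pi.add_apply, h1, h3, Pi.smul_apply, h4, Finset.sum_insert hi, smul_eq_mul]

/-- The Sobolev estimate `IsTestFunction.sq_setLIntegral_sq_le`, in terms of `L²` norms. -/
lemma IsTestFunction.toReal_setLIntegral_sq_le {Ω : Set ℍ} (hΩ : MeasurableSet Ω) {φ : ℂ → ℝ}
    (h : IsTestFunction Ω φ) {p : L2Fun × L2Vec} (h1 : ∀ᵐ z : ℍ, p.1 z = φ (z : ℂ))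
    (h2 : ∀ᵐ z : ℍ, p.2 z = hypGrad φ z) (A : Set ℍ) {m : ℝ} (hm : 0 ≤ m)
    (hA : volume (A ∩ Ω) ≤ ENNReal.ofReal m) :
    ∃ τ : ℝ, 0 ≤ τ ∧ ∫⁻ z : ℍ in A, ‖φ z‖ₑ ^ 2 = ENNReal.ofReal τ ∧
      τ ^ 2 ≤ 4 * m * (‖p.1‖ ^ 2 * ‖p.2‖ ^ 2) := by
  have hx := sq_enorm_eq_lintegral p.1 h1
  have hg := sq_enorm_eq_lintegral p.2 h2
  have hT := h.sq_setLIntegral_sq_le hΩ A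
  rw [← hx, ← hg] at hT
  have hfin : ∫⁻ z : ℍ in A, ‖φ z‖ₑ ^ 2 ≠ ⊤ :=
    ne_top_of_le_ne_top (ENNReal.pow_ne_top enorm_ne_top)
      ((setLIntegral_le_lintegral A _).trans_eq hx.symm)
  refine ⟨(∫⁻ z : ℍ in A, ‖φ z‖ₑ ^ 2).toReal, ENNReal.toReal_nonneg,
    (ENNReal.ofReal_toReal hfin).symm, ?_⟩
  have h3 : (∫⁻ z : ℍ in A, ‖φ z‖ₑ ^ 2) ^ 2
      ≤ ENNReal.ofReal (4 * m * (‖p.1‖ ^ 2 * ‖p.2‖ ^ 2)) := by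
    refine hT.trans ?_
    rw [ENNReal.ofReal_mul (by positivity), ENNReal.ofReal_mul (by norm_num),
      ENNReal.ofReal_mul (by positivity), ← enorm_sq_eq_ofReal, ← enorm_sq_eq_ofReal]
    gcongr
    norm_num
  rw [← ENNReal.toReal_pow]
  exact ENNReal.toReal_le_of_le_ofReal (by positivity) h3

/-- The Faber–Krahn inequality `Vol(Ω) ∫ |∇u|² ≥ ¼ ∫ u²` on `H¹₀(Ω)`. -/
theorem sq_norm_fst_le_of_mem_H10 {Ω : Set ℍ} (hΩ : MeasurableSet Ω)
    (hfin : (volume : Measure ℍ) Ω ≠ ⊤) {p : L2Fun × L2Vec} (hp : p ∈ H10 Ω) :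
    ‖p.1‖ ^ 2 ≤ 4 * (volume Ω).toReal * ‖p.2‖ ^ 2 := by
  have hcl : IsClosed {p : L2Fun × L2Vec | ‖p.1‖ ^ 2 ≤ 4 * (volume Ω).toReal * ‖p.2‖ ^ 2} :=
    isClosed_le (by fun_prop) (by fun_prop)
  refine closure_minimal (fun p ↦ ?_) hcl hp
  rintro ⟨φ, hφ, h1, h2⟩
  obtain ⟨τ, hτ0, hτ, hle⟩ := hφ.toReal_setLIntegral_sq_le hΩ h1 h2 univ ENNReal.toReal_nonneg
    (m := (volume Ω).toReal) (by rw [univ_inter, ENNReal.ofReal_toReal hfin])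
  have hx := sq_enorm_eq_lintegral p.1 h1
  rw [setLIntegral_univ, ← hx, enorm_sq_eq_ofReal,
    ENNReal.ofReal_eq_ofReal_iff (by positivity) hτ0] at hτ
  rw [← hτ] at hle
  rcases (norm_nonneg p.1).eq_or_lt with h0 | h0
  · rw [mem_ofPred_eq, ← h0, zero_pow two_ne_zero]
    positivity
  · refine le_of_mul_le_mul_left (a := ‖p.1‖ ^ 2) ?_ (by positivity)
    calc _ = (‖p.1‖ ^ 2) ^ 2 := by ring
      _ ≤ _ := hle
      _ = _ := by ring

/-- On an open set of finite area, the test functions of bounded `H¹` norm are uniformly close in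
`L²` to a finite-dimensional space: the Poincaré inequality on the tiles gives step functions, and
finitely many tiles suffice since little mass is left outside. -/
theorem exists_finiteDimensional_approx {Ω : Set ℍ} (hΩ : MeasurableSet Ω)
    (hfin : (volume : Measure ℍ) Ω ≠ ⊤) {ε : ℝ} (hε : 0 < ε) :
    ∃ V : Submodule ℝ L2Fun, FiniteDimensional ℝ V ∧ ∀ p ∈ testGraph Ω, ∃ v ∈ V,
      ‖p.1 - v‖ ^ 2 ≤ ε ^ 2 * (‖p.1‖ ^ 2 + ‖p.2‖ ^ 2) := by
  -- the tiles contribute `4κ² = ε² / 4`, and their complement contributes `ε² / 2`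
  set κ := ε / 4 with hκ
  obtain ⟨k, hk, htile⟩ := exists_tiling (κ := κ) (by positivity)
  have : IsFiniteMeasure ((volume : Measure ℍ).restrict Ω) := ⟨by
    rw [Measure.restrict_apply_univ]; exact hfin.lt_top⟩
  obtain ⟨s, hs⟩ := exists_finset_measure_preimage_compl_le ((volume : Measure ℍ).restrict Ω) hk
    (ε := ENNReal.ofReal ((ε ^ 2 / 2) ^ 2)) (by rw [ENNReal.ofReal_pos]; positivity)
  have hkq : ∀ t : Set (ℤ × ℤ), MeasurableSet (k ⁻¹' t) := fun t ↦ hk t.to_countable.measurableSet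
  rw [Measure.restrict_apply (hkq _).compl] at hs
  have hQ : ∀ q, MeasurableSet (k ⁻¹' {q} ∩ Ω) := fun q ↦ (hkq _).inter hΩ
  have hμQ : ∀ q, (volume : Measure ℍ) (k ⁻¹' {q} ∩ Ω) ≠ ⊤ := fun q ↦
    ne_top_of_le_ne_top hfin (measure_mono inter_subset_right)
  refine ⟨Submodule.span ℝ
    ((fun q ↦ indicatorConstLp (2 : ℝ≥0∞) (hQ q) (hμQ q) (1 : ℝ)) '' (s : Set (ℤ × ℤ))),
    FiniteDimensional.span_of_finite ℝ (s.finite_toSet.image _), ?_⟩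
  rintro p ⟨φ, hφ, h1, h2⟩
  have hpoinc : ∀ q, ∃ c : ℝ, ∫⁻ z : ℍ in k ⁻¹' {q}, ‖φ z - c‖ₑ ^ 2
      ≤ ENNReal.ofReal (4 * κ ^ 2) * ∫⁻ z : ℍ in k ⁻¹' {q}, ‖hypGrad φ z‖ₑ ^ 2 := by
    intro q
    obtain ⟨a, b, hb, hab⟩ := htile q
    obtain ⟨c, hc⟩ := exists_setLIntegral_sub_const_le hφ.contDiff_one
      (show 0 < κ by positivity) a hb
    simp_rw [enorm_hypGrad, hab]
    exact ⟨c, hc⟩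
  choose c hc using hpoinc
  obtain ⟨v, hv, hva⟩ := exists_mem_span_indicator (μ := (volume : Measure ℍ)) s hQ hμQ c
  refine ⟨v, hv, ?_⟩
  -- a representative of `v`: it is `c q` on the part in `Ω` of the tile `q ∈ s`, and `0` elsewhere
  set w : ℍ → ℝ := fun z ↦ ∑ q ∈ s, c q * (k ⁻¹' {q} ∩ Ω).indicator (fun _ ↦ 1) z with hw
  have hw_tile : ∀ z ∈ k ⁻¹' (s : Set (ℤ × ℤ)), z ∈ Ω → w z = c (k z) := by
    intro z hz hzΩ
    rw [hw]
    dsimp only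
    rw [Finset.sum_eq_single (k z)]
    · simp [hzΩ]
    · intro q _ hq
      simp [indicator, hq.symm]
    · intro h
      exact absurd hz h
  have hw_off : ∀ z, z ∉ k ⁻¹' (s : Set (ℤ × ℤ)) → w z = 0 := fun z hz ↦
    Finset.sum_eq_zero fun q hq ↦ by
      have : k z ≠ q := fun h ↦ hz (by simpa [h] using hq)
      simp [indicator, this]
  have hw_out : ∀ z ∉ Ω, w z = 0 := fun z hz ↦
    Finset.sum_eq_zero fun q hq ↦ by simp [indicator, hz]
  have hdiff : ∀ᵐ z : ℍ, (p.1 - v : L2Fun) z = φ z - w z := by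
    filter_upwards [h1, hva, Lp.coeFn_sub p.1 v] with z h3 h4 h5
    rw [h5, Pi.sub_apply, h3, h4]
  obtain ⟨τ, hτ0, hτ, hτle⟩ := hφ.toReal_setLIntegral_sq_le hΩ h1 h2
    (k ⁻¹' (s : Set (ℤ × ℤ)))ᶜ (sq_nonneg (ε ^ 2 / 2)) hs
  have hin : ∫⁻ z : ℍ in k ⁻¹' (s : Set (ℤ × ℤ)), ‖φ z - w z‖ₑ ^ 2
      ≤ ENNReal.ofReal (4 * κ ^ 2) * ‖p.2‖ₑ ^ 2 := by
    have hU : k ⁻¹' (s : Set (ℤ × ℤ)) = ⋃ q ∈ s, k ⁻¹' {q} := by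
      ext z; simp
    have hd : (s : Set (ℤ × ℤ)).PairwiseDisjoint fun q ↦ k ⁻¹' {q} := fun q _ q' _ hqq' ↦
      Disjoint.preimage k (by simpa using hqq')
    calc ∫⁻ z : ℍ in k ⁻¹' (s : Set (ℤ × ℤ)), ‖φ z - w z‖ₑ ^ 2
        ≤ ∫⁻ z : ℍ in k ⁻¹' (s : Set (ℤ × ℤ)), ‖φ z - c (k z)‖ₑ ^ 2 := by
          refine setLIntegral_mono' (hkq _) fun z hz ↦ ?_
          by_cases hzΩ : z ∈ Ω
          · rw [hw_tile z hz hzΩ]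
          · simp [hw_out z hzΩ, hφ.eq_zero_of_notMem hzΩ]
      _ = ∑ q ∈ s, ∫⁻ z : ℍ in k ⁻¹' {q}, ‖φ z - c (k z)‖ₑ ^ 2 := by
          rw [hU, lintegral_biUnion_finset hd fun q _ ↦ hkq _]
      _ = ∑ q ∈ s, ∫⁻ z : ℍ in k ⁻¹' {q}, ‖φ z - c q‖ₑ ^ 2 :=
          Finset.sum_congr rfl fun q _ ↦ setLIntegral_congr_fun (hkq _) fun z hz ↦ by
            rw [show k z = q from hz]
      _ ≤ ∑ q ∈ s, ENNReal.ofReal (4 * κ ^ 2) * ∫⁻ z : ℍ in k ⁻¹' {q}, ‖hypGrad φ z‖ₑ ^ 2 :=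
          Finset.sum_le_sum fun q _ ↦ hc q
      _ = ENNReal.ofReal (4 * κ ^ 2) *
            ∫⁻ z : ℍ in k ⁻¹' (s : Set (ℤ × ℤ)), ‖hypGrad φ z‖ₑ ^ 2 := by
          rw [hU, lintegral_biUnion_finset hd fun q _ ↦ hkq _, Finset.mul_sum]
      _ ≤ _ := by
          rw [sq_enorm_eq_lintegral p.2 h2]
          gcongr
          exact Measure.restrict_le_self
  have hout : ∫⁻ z : ℍ in (k ⁻¹' (s : Set (ℤ × ℤ)))ᶜ, ‖φ z - w z‖ₑ ^ 2 = ENNReal.ofReal τ := by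
    rw [← hτ]
    exact setLIntegral_congr_fun (hkq _).compl fun z hz ↦ by simp [hw_off z hz]
  have htotal : ENNReal.ofReal (‖p.1 - v‖ ^ 2)
      ≤ ENNReal.ofReal (4 * κ ^ 2 * ‖p.2‖ ^ 2 + τ) := by
    rw [ENNReal.ofReal_add (by positivity) hτ0, ENNReal.ofReal_mul (by positivity),
      ← enorm_sq_eq_ofReal, ← enorm_sq_eq_ofReal, sq_enorm_eq_lintegral _ hdiff,
      ← lintegral_add_compl _ (hkq s), hout]
    gcongr
  have htotal' := (ENNReal.ofReal_le_ofReal_iff (by positivity)).1 htotal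
  have hτ' : τ ≤ ε ^ 2 / 2 * (‖p.1‖ ^ 2 + ‖p.2‖ ^ 2) := by
    refine le_of_sq_le_sq (hτle.trans ?_) (by positivity)
    have := four_mul_le_sq_add (‖p.1‖ ^ 2) (‖p.2‖ ^ 2)
    calc 4 * (ε ^ 2 / 2) ^ 2 * (‖p.1‖ ^ 2 * ‖p.2‖ ^ 2)
        = (ε ^ 2 / 2) ^ 2 * (4 * ‖p.1‖ ^ 2 * ‖p.2‖ ^ 2) := by ring
      _ ≤ (ε ^ 2 / 2) ^ 2 * (‖p.1‖ ^ 2 + ‖p.2‖ ^ 2) ^ 2 := by gcongr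
      _ = _ := by ring
  have h3 : 4 * κ ^ 2 * ‖p.2‖ ^ 2 ≤ ε ^ 2 / 2 * ‖p.2‖ ^ 2 := by
    rw [hκ]
    gcongr
    linarith [sq_nonneg ε, show 4 * (ε / 4) ^ 2 = ε ^ 2 / 4 by ring]
  have h4 : 0 ≤ ε ^ 2 / 2 * ‖p.1‖ ^ 2 := by positivity
  linarith

/-! ### Singular vectors of compact operators -/

section Abstract

variable {H F : Type*} [NormedAddCommGroup H] [InnerProductSpace ℝ H]
  [NormedAddCommGroup F] [InnerProductSpace ℝ F]

open Filter Topology ContinuousLinearMap in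
/-- A compact operator `T ≠ 0` between Hilbert spaces attains its norm, and a maximizer `u` is an
eigenvector of `T* T` for the eigenvalue `‖T‖²`. -/
theorem exists_inner_map_eq_sq_norm_mul_inner [CompleteSpace H] [CompleteSpace F]
    (T : H →L[ℝ] F) (hT : IsCompactOperator T) (hT0 : T ≠ 0) :
    ∃ u : H, T u ≠ 0 ∧ ∀ v, inner ℝ (T u) (T v) = ‖T‖ ^ 2 * inner ℝ u v := by
  have hpos : 0 < ‖T‖ := norm_pos_iff.2 hT0
  have hseq : ∀ n : ℕ, ∃ x : H, ‖x‖ < 1 ∧ ‖T‖ - 1 / (n + 1) < ‖T x‖ := fun n ↦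
    T.exists_lt_apply_of_lt_opNorm (sub_lt_self _ Nat.one_div_pos_of_nat)
  choose x hx1 hx2 using hseq
  -- a maximizing sequence in the unit ball, whose images converge along a subsequence `ψ`
  have hTx : ∀ n, ‖T (x n)‖ ≤ ‖T‖ := fun n ↦
    (T.le_opNorm _).trans (mul_le_of_le_one_right hpos.le (hx1 n).le)
  have hlim : Tendsto (fun n ↦ ‖T (x n)‖) atTop (𝓝 ‖T‖) := by
    refine tendsto_of_tendsto_of_tendsto_of_le_of_le ?_ tendsto_const_nhds (fun n ↦ (hx2 n).le) hTx
    simpa using (tendsto_const_nhds (x := ‖T‖)).sub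
      (tendsto_one_div_add_atTop_nhds_zero_nat (𝕜 := ℝ))
  obtain ⟨K, hK, hKx⟩ := hT.image_closedBall_subset_compact 1
  obtain ⟨w, -, ψ, hψ, hw⟩ := hK.tendsto_subseq
    (x := fun n ↦ T (x n)) fun n ↦ hKx ⟨x n, by simpa using (hx1 n).le, rfl⟩
  have hlimψ := hlim.comp hψ.tendsto_atTop
  have hwn : ‖w‖ = ‖T‖ := tendsto_nhds_unique hw.norm hlimψ
  set S := adjoint T with hS
  -- `‖T* T x - ‖T‖² x‖² ≤ ‖T‖² (‖T‖² - ‖T x‖²)` on the unit ball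
  have hbound : ∀ n, ‖S (T (x n)) - ‖T‖ ^ 2 • x n‖ ^ 2
      ≤ ‖T‖ ^ 2 * (‖T‖ ^ 2 - ‖T (x n)‖ ^ 2) := by
    intro n
    have h1 : ‖S (T (x n))‖ ≤ ‖T‖ * ‖T (x n)‖ := by
      have := S.le_opNorm (T (x n))
      rwa [hS, LinearIsometryEquiv.norm_map] at this
    have h2 : inner ℝ (S (T (x n))) (x n) = ‖T (x n)‖ ^ 2 := by
      rw [hS, adjoint_inner_left, real_inner_self_eq_norm_sq]
    rw [norm_sub_sq_real, inner_smul_right, h2, norm_smul, norm_pow, norm_norm]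
    have h3 : ‖S (T (x n))‖ ^ 2 ≤ (‖T‖ * ‖T (x n)‖) ^ 2 := by gcongr
    have h4 : (‖T‖ ^ 2 * ‖x n‖) ^ 2 ≤ (‖T‖ ^ 2 * 1) ^ 2 := by gcongr; exact (hx1 n).le
    linarith [h3, h4, show (‖T‖ * ‖T (x n)‖) ^ 2 = ‖T‖ ^ 2 * ‖T (x n)‖ ^ 2 by ring,
      show (‖T‖ ^ 2 * 1) ^ 2 = ‖T‖ ^ 2 * ‖T‖ ^ 2 by ring]
  have hzero : Tendsto (fun n ↦ S (T (x (ψ n))) - ‖T‖ ^ 2 • x (ψ n)) atTop (𝓝 0) := by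
    rw [tendsto_zero_iff_norm_tendsto_zero]
    have h1 : Tendsto (fun n ↦ ‖T‖ ^ 2 * (‖T‖ ^ 2 - ‖T (x (ψ n))‖ ^ 2)) atTop (𝓝 0) := by
      have h2 := ((tendsto_const_nhds (x := ‖T‖ ^ 2)).sub (hlimψ.pow 2)).const_mul (‖T‖ ^ 2)
      rwa [sub_self, mul_zero] at h2
    have h2 := squeeze_zero (fun n ↦ sq_nonneg _) (fun n ↦ hbound (ψ n)) h1
    simpa using h2.sqrt
  have hSw : Tendsto (fun n ↦ S (T (x (ψ n)))) atTop (𝓝 (S w)) := (S.continuous.tendsto w).comp hw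
  have hxu : Tendsto (fun n ↦ x (ψ n)) atTop (𝓝 ((‖T‖ ^ 2)⁻¹ • S w)) := by
    have h1 := (hSw.sub hzero).const_smul (‖T‖ ^ 2)⁻¹
    simpa [smul_smul, hpos.ne'] using h1
  have hTu : T ((‖T‖ ^ 2)⁻¹ • S w) = w :=
    tendsto_nhds_unique ((T.continuous.tendsto _).comp hxu) hw
  refine ⟨(‖T‖ ^ 2)⁻¹ • S w, ?_, fun v ↦ ?_⟩
  · rw [hTu, ← norm_pos_iff, hwn]
    exact hpos
  · rw [hTu, ← adjoint_inner_left, ← hS, inner_smul_left]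
    simp only [conj_trivial]
    rw [mul_inv_cancel_left₀ (by positivity)]

lemma norm_sub_starProjection_le (V : Submodule ℝ F) [V.HasOrthogonalProjection] (y : F) {v : F}
    (hv : v ∈ V) : ‖y - V.starProjection y‖ ≤ ‖y - v‖ := by
  rw [Submodule.starProjection_minimal]
  exact ciInf_le ⟨0, by rintro _ ⟨y, rfl⟩; exact norm_nonneg _⟩ (⟨v, hv⟩ : V)

/-- An operator whose values on the unit ball are uniformly close to finite-dimensional subspaces
is compact. -/
theorem isCompactOperator_of_finiteDimensional_approx [CompleteSpace F] (T : H →L[ℝ] F)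
    (h : ∀ ε > 0, ∃ (V : Submodule ℝ F) (_ : FiniteDimensional ℝ V),
      ∀ u, ‖T u - V.starProjection (T u)‖ ≤ ε * ‖u‖) : IsCompactOperator T := by
  have hn : ∀ n : ℕ, ∃ A : H →L[ℝ] F, IsCompactOperator A ∧ ‖A - T‖ ≤ 1 / (n + 1 : ℝ) := by
    intro n
    obtain ⟨V, hV, happ⟩ := h (1 / (n + 1 : ℝ)) Nat.one_div_pos_of_nat
    refine ⟨V.starProjection ∘L T, ?_, ContinuousLinearMap.opNorm_le_bound _ (by positivity) ?_⟩
    · have : ProperSpace V := FiniteDimensional.proper ℝ V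
      have h1 : IsCompactOperator V.orthogonalProjectionOnto :=
        isCompactOperator_of_locallyCompactSpace_dom _
      exact (h1.clm_comp V.subtypeL).comp_clm T
    · intro u
      rw [sub_apply, ContinuousLinearMap.comp_apply, norm_sub_rev]
      exact happ u
  choose A hA hAT using hn
  refine isCompactOperator_of_tendsto (l := Filter.atTop) (F := A) ?_
    (Filter.Eventually.of_forall hA)
  rw [tendsto_iff_norm_sub_tendsto_zero]
  exact squeeze_zero (fun n ↦ norm_nonneg _) hAT tendsto_one_div_add_atTop_nhds_zero_nat

end Abstract

/-! ### Test functions and the space `H¹₀(Ω)` -/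

lemma IsTestFunction.isCompact_preimage_tsupport {Ω : Set ℍ} {φ : ℂ → ℝ}
    (h : IsTestFunction Ω φ) : IsCompact (UpperHalfPlane.coe ⁻¹' tsupport φ) :=
  (UpperHalfPlane.isOpenEmbedding_coe.isInducing.isCompact_preimage_iff
    (h.tsupport_subset.trans (image_subset_range _ _))).2 h.hasCompactSupport

lemma IsTestFunction.memLp {Ω : Set ℍ} {φ : ℂ → ℝ} (h : IsTestFunction Ω φ) :
    MemLp (fun z : ℍ ↦ φ z) 2 volume := by
  refine h.continuous_comp_coe.memLp_of_hasCompactSupport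
    (HasCompactSupport.intro h.isCompact_preimage_tsupport fun z hz ↦ ?_)
  exact image_eq_zero_of_notMem_tsupport hz

lemma IsTestFunction.memLp_hypGrad {Ω : Set ℍ} {φ : ℂ → ℝ} (h : IsTestFunction Ω φ) :
    MemLp (hypGrad φ) 2 (volume : Measure ℍ) := by
  refine h.continuous_hypGrad.memLp_of_hasCompactSupport
    (HasCompactSupport.intro h.isCompact_preimage_tsupport fun z hz ↦ ?_)
  have : fderiv ℝ φ (z : ℂ) = 0 := by
    by_contra h0
    exact hz (support_fderiv_subset ℝ h0)
  simp [hypGrad, gradient, this]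

/-- The pairs `(φ, ∇φ)` of test functions, as a linear subspace of `L² × L²`. -/
def testSubmodule (Ω : Set ℍ) : Submodule ℝ (L2Fun × L2Vec) where
  carrier := testGraph Ω
  zero_mem' := by
    refine ⟨fun _ ↦ 0, ⟨contDiff_const, HasCompactSupport.zero, by simp [tsupport]⟩, ?_, ?_⟩
    · exact Lp.coeFn_zero ℝ 2 _
    · filter_upwards [Lp.coeFn_zero ℂ 2 (volume : Measure ℍ)] with z hz
      simpa [hypGrad, gradient] using hz
  add_mem' := by
    rintro p q ⟨φ, hφ, h1, h2⟩ ⟨ψ, hψ, h3, h4⟩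
    have hsub : tsupport (fun z ↦ φ z + ψ z) ⊆ tsupport φ ∪ tsupport ψ := tsupport_add φ ψ
    refine ⟨fun z ↦ φ z + ψ z, ⟨hφ.contDiff.add hψ.contDiff,
      hφ.hasCompactSupport.add hψ.hasCompactSupport,
      hsub.trans (union_subset hφ.tsupport_subset hψ.tsupport_subset)⟩, ?_, ?_⟩
    · filter_upwards [h1, h3, Lp.coeFn_add p.1 q.1] with z h5 h6 h7
      rw [Prod.fst_add, h7, Pi.add_apply, h5, h6]
    · filter_upwards [h2, h4, Lp.coeFn_add p.2 q.2] with z h5 h6 h7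
      rw [Prod.snd_add, h7, Pi.add_apply, h5, h6]
      have h8 := fderiv_fun_add (hφ.contDiff_one.differentiable one_ne_zero (z : ℂ))
        (hψ.contDiff_one.differentiable one_ne_zero (z : ℂ))
      simp [hypGrad, gradient, h8]
  smul_mem' := by
    rintro c p ⟨φ, hφ, h1, h2⟩
    have hsub : tsupport (fun z ↦ c * φ z) ⊆ tsupport φ :=
      closure_mono fun z hz h0 ↦ hz (by simp [h0])
    refine ⟨fun z ↦ c * φ z, ⟨contDiff_const.mul hφ.contDiff,
      hφ.hasCompactSupport.of_isClosed_subset (isClosed_tsupport _) hsub,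
      hsub.trans hφ.tsupport_subset⟩, ?_, ?_⟩
    · filter_upwards [h1, Lp.coeFn_smul c p.1] with z h5 h7
      rw [Prod.smul_fst, h7, Pi.smul_apply, h5, smul_eq_mul]
    · filter_upwards [h2, Lp.coeFn_smul c p.2] with z h5 h7
      rw [Prod.smul_snd, h7, Pi.smul_apply, h5]
      have h8 := fderiv_const_mul (hφ.contDiff_one.differentiable one_ne_zero (z : ℂ)) c
      simp [hypGrad, gradient, h8]
      ring

lemma measure_ne_zero_of_isOpen {U : Set ℍ} (hU : IsOpen U) (hne : U.Nonempty) :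
    (volume : Measure ℍ) U ≠ 0 := by
  intro h0
  have hU' : IsOpen (UpperHalfPlane.coe '' U) := UpperHalfPlane.isOpenEmbedding_coe.isOpenMap U hU
  rw [UpperHalfPlane.volume_eq_lintegral, setLIntegral_eq_zero_iff hU'.measurableSet] at h0
  · refine hU'.measure_ne_zero volume (hne.image _) (measure_mono_null ?_ h0)
    rintro _ ⟨z, hz, rfl⟩ h
    simpa [z.im_ne_zero] using h (mem_image_of_mem _ hz)
  · fun_prop

/-- There are non-zero test functions. -/
lemma exists_mem_testGraph_fst_ne_zero {Ω : Set ℍ} (hΩ : IsOpen Ω) (hne : Ω.Nonempty) :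
    ∃ p ∈ testGraph Ω, p.1 ≠ 0 := by
  obtain ⟨z₀, hz₀⟩ := hne
  have hΩ' : UpperHalfPlane.coe '' Ω ∈ nhds (z₀ : ℂ) :=
    (UpperHalfPlane.isOpenEmbedding_coe.isOpenMap Ω hΩ).mem_nhds (mem_image_of_mem _ hz₀)
  obtain ⟨φ, hsupp, hcomp, hsmooth, -, hone⟩ := exists_contDiff_tsupport_subset (n := ⊤) hΩ'
  have hφ : IsTestFunction Ω φ := ⟨hsmooth, hcomp, hsupp⟩
  refine ⟨(hφ.memLp.toLp, hφ.memLp_hypGrad.toLp),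
    ⟨φ, hφ, hφ.memLp.coeFn_toLp, hφ.memLp_hypGrad.coeFn_toLp⟩, fun h0 ↦ ?_⟩
  have h1 : ∀ᵐ z : ℍ, φ z = 0 := by
    filter_upwards [hφ.memLp.coeFn_toLp, Lp.coeFn_zero ℝ 2 (volume : Measure ℍ)] with z h2 h3
    have h0' : hφ.memLp.toLp = 0 := h0
    rw [← h2, h0', h3, Pi.zero_apply]
  exact measure_ne_zero_of_isOpen (isOpen_ne_fun hφ.continuous_comp_coe continuous_const)
    ⟨z₀, by simp [hone]⟩ h1

/-- `H¹₀(Ω)` as a subspace of the Hilbert space `L² ⊕ L²`, whose norm on the pairs `(u, ∇u)` is the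
`H¹` norm. -/
def H10Submodule (Ω : Set ℍ) : Submodule ℝ (WithLp 2 (L2Fun × L2Vec)) :=
  (testSubmodule Ω).topologicalClosure.comap
    (WithLp.prodContinuousLinearEquiv 2 ℝ L2Fun L2Vec : WithLp 2 (L2Fun × L2Vec) →ₗ[ℝ] _)

lemma mem_H10Submodule {Ω : Set ℍ} {u : WithLp 2 (L2Fun × L2Vec)} :
    u ∈ H10Submodule Ω ↔ (u.fst, u.snd) ∈ H10 Ω := Iff.rfl

instance (Ω : Set ℍ) : CompleteSpace (H10Submodule Ω) :=
  ((testSubmodule Ω).isClosed_topologicalClosure.preimage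
    (WithLp.prodContinuousLinearEquiv 2 ℝ L2Fun L2Vec).continuous).completeSpace_coe

/-- The inclusion of `H¹₀(Ω)` into `L²`. -/
def H10Inclusion (Ω : Set ℍ) : H10Submodule Ω →L[ℝ] L2Fun :=
  WithLp.fstL 2 ℝ L2Fun L2Vec ∘L (H10Submodule Ω).subtypeL

/-- Rellich's theorem: the inclusion of `H¹₀(Ω)` into `L²` is compact if `Ω` has finite area. -/
theorem isCompactOperator_H10Inclusion {Ω : Set ℍ} (hΩ : MeasurableSet Ω)
    (hfin : (volume : Measure ℍ) Ω ≠ ⊤) : IsCompactOperator (H10Inclusion Ω) := by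
  refine isCompactOperator_of_finiteDimensional_approx _ fun ε hε ↦ ?_
  obtain ⟨V, hV, happ⟩ := exists_finiteDimensional_approx hΩ hfin hε
  refine ⟨V, hV, fun u ↦ ?_⟩
  have hcl : IsClosed {p : L2Fun × L2Vec |
      ‖p.1 - V.starProjection p.1‖ ^ 2 ≤ ε ^ 2 * (‖p.1‖ ^ 2 + ‖p.2‖ ^ 2)} :=
    isClosed_le (by fun_prop) (by fun_prop)
  have hmem := closure_minimal (fun p hp ↦ ?_) hcl (mem_H10Submodule.1 u.2)
  · have hnorm : ‖u‖ ^ 2 = ‖(u : WithLp 2 (L2Fun × L2Vec)).fst‖ ^ 2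
        + ‖(u : WithLp 2 (L2Fun × L2Vec)).snd‖ ^ 2 := WithLp.prod_norm_sq_eq_of_L2 _
    refine le_of_sq_le_sq ?_ (by positivity)
    rw [mul_pow, hnorm]
    exact hmem
  · obtain ⟨v, hv, hle⟩ := happ p hp
    refine le_trans ?_ hle
    gcongr
    exact norm_sub_starProjection_le V _ hv

/-! ### The first eigenvalue -/

lemma SolvesDirichlet.sq_norm_snd {Ω : Set ℍ} {μ : ℝ} {u : L2Fun × L2Vec}
    (h : SolvesDirichlet Ω μ u) : ‖u.2‖ ^ 2 = μ * ‖u.1‖ ^ 2 := by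
  simpa [real_inner_self_eq_norm_sq] using h.2 u h.1

/-- The least eigenvalue is `‖ι‖⁻² - 1`, where `ι` is the inclusion of `H¹₀(Ω)` into `L²`. -/
theorem exists_isLeast_dirichletEigenvalues {Ω : Set ℍ} (hΩ : IsOpen Ω) (hne : Ω.Nonempty)
    (hfin : (volume : Measure ℍ) Ω ≠ ⊤) : ∃ μ, IsLeast (dirichletEigenvalues Ω) μ := by
  set T := H10Inclusion Ω with hT
  obtain ⟨p, hp, hp0⟩ := exists_mem_testGraph_fst_ne_zero hΩ hne
  have hT0 : T ≠ 0 := fun h0 ↦ hp0 <| by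
    have h1 : T ⟨WithLp.toLp 2 p, mem_H10Submodule.2 (subset_closure hp)⟩ = 0 := by rw [h0]; rfl
    exact h1
  obtain ⟨u, hu0, hu⟩ := exists_inner_map_eq_sq_norm_mul_inner T
    (isCompactOperator_H10Inclusion hΩ.measurableSet hfin) hT0
  have hpos : 0 < ‖T‖ := (norm_nonneg T).lt_of_ne' fun h0 ↦ hu0 <| norm_le_zero_iff.1 <| by
    have h1 := T.le_opNorm u
    rwa [h0, zero_mul] at h1
  refine ⟨(‖T‖ ^ 2)⁻¹ - 1, ⟨((u : WithLp 2 (L2Fun × L2Vec)).fst,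
    (u : WithLp 2 (L2Fun × L2Vec)).snd), hu0, u.2, fun v hv ↦ ?_⟩, ?_⟩
  · have h1 : inner ℝ (u : WithLp 2 (L2Fun × L2Vec)).fst v.1
        = ‖T‖ ^ 2 * (inner ℝ (u : WithLp 2 (L2Fun × L2Vec)).fst v.1
          + inner ℝ (u : WithLp 2 (L2Fun × L2Vec)).snd v.2) :=
      hu ⟨WithLp.toLp 2 v, mem_H10Submodule.2 hv⟩
    dsimp only
    field_simp
    linarith
  · rintro μ ⟨v, hv0, hv⟩
    have hv1 : 0 < ‖v.1‖ ^ 2 := by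
      have := norm_pos_iff.2 hv0
      positivity
    set w : H10Submodule Ω := ⟨WithLp.toLp 2 v, mem_H10Submodule.2 hv.1⟩
    have h1 : ‖v.1‖ ≤ ‖T‖ * ‖w‖ := T.le_opNorm w
    have h2 : ‖w‖ ^ 2 = ‖v.1‖ ^ 2 + ‖v.2‖ ^ 2 := WithLp.prod_norm_sq_eq_of_L2 _
    have h3 : ‖v.1‖ ^ 2 ≤ (‖T‖ * ‖w‖) ^ 2 := by gcongr
    rw [mul_pow, h2, hv.sq_norm_snd] at h3
    have h4 : 1 ≤ ‖T‖ ^ 2 * (1 + μ) := by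
      refine le_of_mul_le_mul_right ?_ hv1
      linarith
    rw [sub_le_iff_le_add', inv_le_iff_one_le_mul₀' (by positivity)]
    exact h4

/-- The Faber–Krahn inequality for eigenvalues. -/
theorem div_volume_le_of_mem_dirichletEigenvalues {Ω : Set ℍ} (hΩ : MeasurableSet Ω)
    (hfin : (volume : Measure ℍ) Ω ≠ ⊤) {μ : ℝ} (hμ : μ ∈ dirichletEigenvalues Ω) :
    1 / 4 / ((volume : Measure ℍ) Ω).toReal ≤ μ := by
  obtain ⟨u, hu0, hu⟩ := hμ
  have hu1 : 0 < ‖u.1‖ ^ 2 := by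
    have := norm_pos_iff.2 hu0
    positivity
  have h1 := sq_norm_fst_le_of_mem_H10 hΩ hfin hu.1
  rw [hu.sq_norm_snd] at h1
  have h2 : 1 ≤ 4 * (volume Ω).toReal * μ := by
    refine le_of_mul_le_mul_right ?_ hu1
    linarith
  have h3 : 0 < ((volume : Measure ℍ) Ω).toReal := by
    refine lt_of_le_of_ne ENNReal.toReal_nonneg fun h0 ↦ ?_
    rw [← h0] at h2
    norm_num at h2
  rw [div_le_iff₀ h3]
  linarith

end HypDirichlet

end

/-- For domains `Ω` of hyperbolic area at most `ε₀`: there is a smallest Dirichlet eigenvalue, it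
is `λ₁(Ω)`, and it is at least `C₀ / Vol(Ω)`. -/
theorem mainTheorem8 (ε₀ : ℝ) (hε₀ : 0 < ε₀) :
    ∃ C₀ : ℝ, 0 < C₀ ∧ ∀ Ω : Set ℍ, IsOpen Ω → IsConnected Ω →
      (volume : Measure ℍ) Ω ≤ ENNReal.ofReal ε₀ →
        IsLeast (HypDirichlet.dirichletEigenvalues Ω) (HypDirichlet.lambda1 Ω) ∧
        C₀ / ((volume : Measure ℍ) Ω).toReal ≤ HypDirichlet.lambda1 Ω := by
  refine ⟨1 / 4, by norm_num, fun Ω hΩ hconn hvol ↦ ?_⟩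
  have hfin : (volume : Measure ℍ) Ω ≠ ⊤ := ne_top_of_le_ne_top ENNReal.ofReal_ne_top hvol
  obtain ⟨μ, hμ⟩ := HypDirichlet.exists_isLeast_dirichletEigenvalues hΩ hconn.nonempty hfin
  have hleast : IsLeast (HypDirichlet.dirichletEigenvalues Ω) (HypDirichlet.lambda1 Ω) := by
    rw [HypDirichlet.lambda1, hμ.csInf_eq]
    exact hμ
  exact ⟨hleast, HypDirichlet.div_volume_le_of_mem_dirichletEigenvalues hΩ.measurableSet hfin
    hleast.1⟩
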